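/- Let $\mathfrak S$ be the Schrödinger algebra: the complex Lie algebra with basis $e,h,f,p,q,z$ and brackets $[h,e]=2e$, $[h,f]=-2f$, $[e,f]=h$, $[h,p]=p$, $[h,q]=-q$, $[p,q]=z$, $[e,q]=p$, $[p,f]=-q$, $[f,q]=0$, $[e,p]=0$, $[z,\mathfrak S]=0$, and let $\mathcal H=\mathrm{span}_{\mathbb C}\{p,q,z\}$ be its Heisenberg subalgebra. For a Lie algebra homomorphism $\phi:\mathcal H\to\mathbb C$, a quasi-Whittaker vector of type $\phi$ in an $\mathfrak S$-module $V$ is a nonzero $v\in V$ with $xv=\phi(x)v$ for all $x\in\mathcal H$, and $V$ is a quasi-Whittaker module of type $\phi$ if it is generated by such a vector. Let $\mathbb C_\phi=\mathbb Cw$ be the one-dimensional $\mathcal H$-module on which $x\in\mathcal H$ acts by $\phi(x)$, let $M_\phi=U(\mathfrak S)\otimes_{U(\mathcal H)}\mathbb C_\phi$, write $w$ also for $1\otimes w\in M_\phi$, put $C=\phi(p)^2f-\phi(q)^2e-\phi(p)\phi(q)h$, and for $\xi\in\mathbb C$ let $$L_{\phi,\xi}=M_\phi/U(\mathfrak S)(C-\xi)w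 .$$ Finally let $C_0=p^2f-q^2e-hpq\in U(\mathfrak S)$. **Theorem.** Let $\phi:\mathcal H\to\mathbb C$ be a Lie algebra homomorphism with $\phi(p)\neq0$ or $\phi(q)\neq0$. 1. For every $\xi\in\mathbb C$, $L_{\phi,\xi}$ is a simple quasi-Whittaker module of type $\phi$. 2. If $L_{\phi,\xi}\cong L_{\phi,\xi'}$, then $\xi=\xi'$. 3. Every simple quasi-Whittaker module $V$ of type $\phi$ is isomorphic to $L_{\phi,\xi}$ for some $\xi\in\mathbb C$. Moreover, for every $\xi\in\mathbb C$, one has $V\cong L_{\phi,\xi}$ if and only if $C_0$ acts on $V$ as multiplication by $\xi$. -/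

import Mathlib

open scoped TensorProduct

-- An associative algebra is a Lie algebra for the commutator; on `ℂ` the bracket is zero.
attribute [local instance 100] LieRing.ofAssociativeRing
attribute [local instance 100] LieAlgebra.ofAssociativeAlgebra

noncomputable section

/-- The Schrödinger algebra: the complex vector space with basis `e, h, f, p, q, z`;
an element is given by its six coordinates. -/
@[ext] structure Schrodinger where
  e : ℂ
  h : ℂ
  f : ℂ
  p : ℂ
  q : ℂ
  z : ℂ

namespace Schrodinger

instance : Zero Schrodinger := ⟨⟨0, 0, 0, 0, 0, 0⟩⟩
instance : Add Schrodinger :=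
  ⟨fun x y => ⟨x.e + y.e, x.h + y.h, x.f + y.f, x.p + y.p, x.q + y.q, x.z + y.z⟩⟩
instance : Neg Schrodinger := ⟨fun x => ⟨-x.e, -x.h, -x.f, -x.p, -x.q, -x.z⟩⟩
instance : SMul ℂ Schrodinger :=
  ⟨fun c x => ⟨c * x.e, c * x.h, c * x.f, c * x.p, c * x.q, c * x.z⟩⟩

/-- The bilinear extension of the relations
`[h,e] = 2e`, `[h,f] = -2f`, `[e,f] = h`, `[h,p] = p`, `[h,q] = -q`, `[p,q] = z`,
`[e,q] = p`, `[p,f] = -q`, `[f,q] = 0`, `[e,p] = 0`, `[z,·] = 0`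
(these relations are verified in `bracket_relations` below). -/
instance : Bracket Schrodinger Schrodinger :=
  ⟨fun x y =>
    { e := 2 * (x.h * y.e - x.e * y.h)
      h := x.e * y.f - x.f * y.e
      f := -2 * (x.h * y.f - x.f * y.h)
      p := (x.h * y.p - x.p * y.h) + (x.e * y.q - x.q * y.e)
      q := -(x.h * y.q - x.q * y.h) - (x.p * y.f - x.f * y.p)
      z := x.p * y.q - x.q * y.p }⟩

section coordinates

variable (x y : Schrodinger) (c : ℂ)

@[simp] theorem zero_e : (0 : Schrodinger).e = 0 := rfl
@[simp] theorem zero_h : (0 : Schrodinger).h = 0 := rfl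
@[simp] theorem zero_f : (0 : Schrodinger).f = 0 := rfl
@[simp] theorem zero_p : (0 : Schrodinger).p = 0 := rfl
@[simp] theorem zero_q : (0 : Schrodinger).q = 0 := rfl
@[simp] theorem zero_z : (0 : Schrodinger).z = 0 := rfl
@[simp] theorem add_e : (x + y).e = x.e + y.e := rfl
@[simp] theorem add_h : (x + y).h = x.h + y.h := rfl
@[simp] theorem add_f : (x + y).f = x.f + y.f := rfl
@[simp] theorem add_p : (x + y).p = x.p + y.p := rfl
@[simp] theorem add_q : (x + y).q = x.q + y.q := rfl
@[simp] theorem add_z : (x + y).z = x.z + y.z := rfl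
@[simp] theorem neg_e : (-x).e = -x.e := rfl
@[simp] theorem neg_h : (-x).h = -x.h := rfl
@[simp] theorem neg_f : (-x).f = -x.f := rfl
@[simp] theorem neg_p : (-x).p = -x.p := rfl
@[simp] theorem neg_q : (-x).q = -x.q := rfl
@[simp] theorem neg_z : (-x).z = -x.z := rfl
@[simp] theorem smul_e : (c • x).e = c * x.e := rfl
@[simp] theorem smul_h : (c • x).h = c * x.h := rfl
@[simp] theorem smul_f : (c • x).f = c * x.f := rfl
@[simp] theorem smul_p : (c • x).p = c * x.p := rfl
@[simp] theorem smul_q : (c • x).q = c * x.q := rfl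
@[simp] theorem smul_z : (c • x).z = c * x.z := rfl
@[simp] theorem lie_e : ⁅x, y⁆.e = 2 * (x.h * y.e - x.e * y.h) := rfl
@[simp] theorem lie_h : ⁅x, y⁆.h = x.e * y.f - x.f * y.e := rfl
@[simp] theorem lie_f : ⁅x, y⁆.f = -2 * (x.h * y.f - x.f * y.h) := rfl
@[simp] theorem lie_p :
    ⁅x, y⁆.p = (x.h * y.p - x.p * y.h) + (x.e * y.q - x.q * y.e) := rfl
@[simp] theorem lie_q :
    ⁅x, y⁆.q = -(x.h * y.q - x.q * y.h) - (x.p * y.f - x.f * y.p) := rfl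
@[simp] theorem lie_z : ⁅x, y⁆.z = x.p * y.q - x.q * y.p := rfl

end coordinates

instance : AddCommGroup Schrodinger where
  add_assoc x y z := by ext <;> simp [add_assoc]
  zero_add x := by ext <;> simp
  add_zero x := by ext <;> simp
  neg_add_cancel x := by ext <;> simp
  add_comm x y := by ext <;> simp [add_comm]
  nsmul := nsmulRec
  zsmul := zsmulRec

instance : Module ℂ Schrodinger where
  one_smul x := by ext <;> simp
  mul_smul a b x := by ext <;> simp [mul_assoc]
  smul_zero a := by ext <;> simp
  smul_add a x y := by ext <;> simp [mul_add]
  add_smul a b x := by ext <;> simp [add_mul]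
  zero_smul x := by ext <;> simp

instance : LieRing Schrodinger where
  add_lie x y z := by ext <;> simp <;> ring
  lie_add x y z := by ext <;> simp <;> ring
  lie_self x := by ext <;> simp <;> ring
  leibniz_lie x y z := by ext <;> simp <;> ring

instance : LieAlgebra ℂ Schrodinger where
  lie_smul c x y := by ext <;> simp <;> ring

/-! The six basis vectors. -/

def E : Schrodinger := ⟨1, 0, 0, 0, 0, 0⟩
def H : Schrodinger := ⟨0, 1, 0, 0, 0, 0⟩
def F : Schrodinger := ⟨0, 0, 1, 0, 0, 0⟩
def P : Schrodinger := ⟨0, 0, 0, 1, 0, 0⟩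
def Q : Schrodinger := ⟨0, 0, 0, 0, 1, 0⟩
def Z : Schrodinger := ⟨0, 0, 0, 0, 0, 1⟩

theorem bracket_relations :
    ⁅H, E⁆ = (2 : ℂ) • E ∧ ⁅H, F⁆ = (-2 : ℂ) • F ∧ ⁅E, F⁆ = H ∧
    ⁅H, P⁆ = P ∧ ⁅H, Q⁆ = -Q ∧ ⁅P, Q⁆ = Z ∧
    ⁅E, Q⁆ = P ∧ ⁅P, F⁆ = -Q ∧ ⁅F, Q⁆ = 0 ∧ ⁅E, P⁆ = 0 ∧ ∀ x : Schrodinger, ⁅Z, x⁆ = 0 := by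
  refine ⟨?_, ?_, ?_, ?_, ?_, ?_, ?_, ?_, ?_, ?_, fun x => ?_⟩ <;>
    ext <;> simp [E, H, F, P, Q, Z]

/-- The Heisenberg subalgebra `span {p, q, z}`. -/
def heisenberg : LieSubalgebra ℂ Schrodinger where
  toSubmodule := Submodule.span ℂ {P, Q, Z}
  lie_mem' := by
    intro x y hx hy
    simp only [AddSubsemigroup.mem_carrier, AddSubmonoid.mem_toSubsemigroup,
      Submodule.mem_toAddSubmonoid, Submodule.mem_span_triple] at hx hy ⊢
    obtain ⟨a, b, c, rfl⟩ := hx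
    obtain ⟨a', b', c', rfl⟩ := hy
    exact ⟨0, 0, a * b' - b * a', by ext <;> (simp [P, Q, Z]; try ring)⟩

/-- `p` and `q` as elements of the Heisenberg subalgebra. -/
def heisenbergP : heisenberg := ⟨P, Submodule.subset_span (by simp)⟩
def heisenbergQ : heisenberg := ⟨Q, Submodule.subset_span (by simp)⟩

/-- The universal enveloping algebra `U(𝔖)`. -/
abbrev U : Type := UniversalEnvelopingAlgebra ℂ Schrodinger

/-- The universal enveloping algebra `U(ℋ)` of the Heisenberg subalgebra. -/
abbrev UH : Type := UniversalEnvelopingAlgebra ℂ heisenberg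

/-- The canonical map `𝔖 → U(𝔖)`. -/
abbrev toU : Schrodinger →ₗ⁅ℂ⁆ U := UniversalEnvelopingAlgebra.ι ℂ

/-- The canonical map `U(ℋ) → U(𝔖)` induced by the inclusion `ℋ ⊆ 𝔖`. -/
def inclU : UH →ₐ[ℂ] U :=
  UniversalEnvelopingAlgebra.lift ℂ (toU.comp heisenberg.incl)

/-! ### Quasi-Whittaker modules -/

/-- `v` is a quasi-Whittaker vector of type `φ`: it is nonzero and `x v = φ(x) v` for `x ∈ ℋ`. -/
def IsQuasiWhittakerVector {V : Type*} [AddCommGroup V] [Module ℂ V]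
    [LieRingModule Schrodinger V] (φ : heisenberg →ₗ⁅ℂ⁆ ℂ) (v : V) : Prop :=
  v ≠ 0 ∧ ∀ x : heisenberg, ⁅(x : Schrodinger), v⁆ = φ x • v

/-- `V` is a quasi-Whittaker module of type `φ`: it is generated, as a module over the
Schrödinger algebra, by a quasi-Whittaker vector of type `φ`. -/
def IsQuasiWhittakerModule (φ : heisenberg →ₗ⁅ℂ⁆ ℂ) (V : Type*) [AddCommGroup V] [Module ℂ V]
    [LieRingModule Schrodinger V] : Prop :=
  ∃ v : V, IsQuasiWhittakerVector φ v ∧ LieSubmodule.lieSpan ℂ Schrodinger {v} = ⊤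

/-- The action of `U(𝔖)` on an `𝔖`-module, extending the action of `𝔖`. -/
def actU (V : Type*) [AddCommGroup V] [Module ℂ V]
    [LieRingModule Schrodinger V] [LieModule ℂ Schrodinger V] : U →ₐ[ℂ] Module.End ℂ V :=
  UniversalEnvelopingAlgebra.lift ℂ (LieModule.toEnd ℂ Schrodinger V)

/-- The element `C₀ = p² f - q² e - h p q` of `U(𝔖)`. -/
def C₀ : U := toU P ^ 2 * toU F - toU Q ^ 2 * toU E - toU H * toU P * toU Q

/-- `C₀` acts on `V` as multiplication by the scalar `ξ`. -/
def C₀ActsBy (V : Type*) [AddCommGroup V] [Module ℂ V]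
    [LieRingModule Schrodinger V] [LieModule ℂ Schrodinger V] (ξ : ℂ) : Prop :=
  ∀ v : V, actU V C₀ v = ξ • v

/-! ### The universal quasi-Whittaker module `M_φ` and its quotients `L_{φ,ξ}` -/

variable (φ : heisenberg →ₗ⁅ℂ⁆ ℂ)

/-- The one-dimensional `ℋ`-module `ℂ_φ`: the space `ℂ`, on which `x ∈ ℋ` acts by `φ(x)`;
as a `U(ℋ)`-module. -/
def OneDim (_φ : heisenberg →ₗ⁅ℂ⁆ ℂ) : Type := ℂ

instance : AddCommGroup (OneDim φ) := inferInstanceAs (AddCommGroup ℂ)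
instance : Module ℂ (OneDim φ) := inferInstanceAs (Module ℂ ℂ)
instance : Module UH (OneDim φ) :=
  Module.compHom ℂ (UniversalEnvelopingAlgebra.lift ℂ φ : UH →ₐ[ℂ] ℂ).toRingHom

/-- The generator `w` of `ℂ_φ`. -/
def OneDim.w : OneDim φ := (1 : ℂ)

/-- The relations `u a ⊗ c = u ⊗ a c` for `a ∈ U(ℋ)`, which turn the tensor product over `ℂ` into
the tensor product over `U(ℋ)`. The set of all `u a ⊗ c - u ⊗ a c` is stable under left
multiplication by `U(𝔖)`, so its `U(𝔖)`-span is also its additive span. -/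
def balancing : Submodule U (U ⊗[ℂ] OneDim φ) :=
  Submodule.span U
    {t | ∃ (u : U) (a : UH) (c : OneDim φ), t = (u * inclU a) ⊗ₜ[ℂ] c - u ⊗ₜ[ℂ] (a • c)}

/-- The universal quasi-Whittaker module `M_φ = U(𝔖) ⊗_{U(ℋ)} ℂ_φ`, as a left `U(𝔖)`-module. -/
abbrev M : Type := (U ⊗[ℂ] OneDim φ) ⧸ balancing φ

/-- The cyclic quasi-Whittaker vector `w = 1 ⊗ w` of `M_φ`. -/
def M.w : M φ := Submodule.Quotient.mk (1 ⊗ₜ[ℂ] OneDim.w φ)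

/-- The element `C = φ(p)² f - φ(q)² e - φ(p) φ(q) h` of `U(𝔖)`. -/
def C : U :=
  toU (φ heisenbergP ^ 2 • F - φ heisenbergQ ^ 2 • E - (φ heisenbergP * φ heisenbergQ) • H)

/-- The submodule `W_{φ,ξ} = U(𝔖) (C - ξ) w` of `M_φ`. -/
def W (ξ : ℂ) : Submodule U (M φ) :=
  Submodule.span U {(C φ - algebraMap ℂ U ξ) • M.w φ}

/-- The module `L_{φ,ξ} = M_φ / W_{φ,ξ}`. -/
abbrev L (ξ : ℂ) : Type := M φ ⧸ W φ ξ

/-- The action of the Schrödinger algebra on `L_{φ,ξ}`, through `𝔖 → U(𝔖)`. -/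
instance (ξ : ℂ) : LieRingModule Schrodinger (L φ ξ) where
  bracket x v := toU x • v
  add_lie x y v := by simp only [map_add, add_smul]
  lie_add x v v' := smul_add _ _ _
  leibniz_lie x y v := by
    simp only [LieHom.map_lie, LieRing.of_associative_ring_bracket, sub_smul, mul_smul,
      sub_add_cancel]

instance (ξ : ℂ) : LieModule ℂ Schrodinger (L φ ξ) where
  smul_lie c x v := by
    change toU (c • x) • v = c • (toU x • v)
    rw [map_smul, smul_assoc]
  lie_smul c x v := by
    change toU x • (c • v) = c • (toU x • v)
    exact smul_comm _ _ _

end Schrodinger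

end

/-!
Since `φ` is a homomorphism, `φ(z) = 0`, so `z` kills every module generated by a quasi-Whittaker
vector, and modulo `z` the element `C₀` is central in `U(𝔖)`. On a quasi-Whittaker vector `C₀` and
`C` act in the same way.

The group `SL₂` acts on `𝔖` by automorphisms, and as `(φ(p), φ(q)) ≠ 0` some automorphism `σ` moves
`φ` to the functional `p ↦ 1`, `q ↦ 0`; it satisfies `σ f = C` (`Schrodinger.exists_automorphism`).
For this functional a vector `w` with `f w = ξ w` generates a module spanned by the `eⁱ hʲ w`, and
the commutation rules tell how `𝔖` acts on these. The resulting formulas define a representation on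
`ℂ[Y][X]`, with `Xⁱ Yʲ` for `eⁱ hʲ w`: with `T_c` the shift `Y ↦ Y + c` and `∂ = ∂/∂X`,

`e = X`, `h = Y + 2X∂`, `p = T₋₁`, `q = -∂T₋₁`, `f = ξT₂ - Y∂ - X∂²`, `z = 0`.

This polynomial model is simple: `q` lowers the degree in `X`, the difference operator `p - 1`
lowers the degree in `Y`, and `e`, `h` generate everything from `1`
(`SchrodingerModel.eq_top_of_ne_bot`). It maps to every module with such a vector
(`SchrodingerModel.orbitMap_rep`), so all modules generated by a quasi-Whittaker vector on which `C`
acts by `ξ` are isomorphic to it, hence simple and isomorphic to one another. In particular no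
Poincaré-Birkhoff-Witt theorem is needed: the model itself shows that `L_{φ,ξ}` is nonzero
(`Schrodinger.L.w_ne_zero`).

It remains to see that `C₀` acts by a scalar on a simple quasi-Whittaker module. Such a module has
countable dimension, so `C₀ - ξ` fails to be invertible for some `ξ`, the vectors `(C₀ - a)⁻¹ v`
being otherwise linearly independent for uncountably many `a`
(`exists_not_isUnit_sub_algebraMap`); by simplicity `C₀ - ξ` then vanishes. The scalar is an
isomorphism invariant, and equals `ξ` on `L_{φ,ξ}`.
-/

/-! ### A countable-dimensional form of Schur's lemma -/

section Resolvent

open Polynomial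

variable {K V : Type*} [Field K] [AddCommGroup V] [Module K V]

/-- If all `T - a` are invertible, then so are all nonzero polynomials in `T`; clearing
denominators in a linear relation between the vectors `(T - a)⁻¹ v` gives such a polynomial that
kills `v`. -/
theorem linearIndependent_resolvent [IsAlgClosed K] (T : Module.End K V) (R : K → Module.End K V)
    (hR : ∀ a, (T - algebraMap K _ a) * R a = 1)
    (hu : ∀ a, IsUnit (T - algebraMap K _ a)) {v : V} (hv : v ≠ 0) :
    LinearIndependent K fun a => R a v := by
  classical
  have key : ∀ p : K[X], aeval T p v = 0 → p = 0 := by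
    intro p hp
    by_contra hp0
    have hun : IsUnit (aeval T p) := by
      rw [(IsAlgClosed.splits p).eq_prod_roots, map_mul, aeval_C]
      refine ((IsUnit.mk0 _ (leadingCoeff_ne_zero.mpr hp0)).map _).mul ?_
      by_contra hnu
      obtain ⟨a, ha, -⟩ := spectrum.exists_mem_of_not_isUnit_aeval_prod hnu
      apply ha
      have := (hu a).neg
      rwa [neg_sub] at this
    obtain ⟨u, hu'⟩ := hun
    apply hv
    have : (u⁻¹.1 * u.1) v = 0 := by
      rw [Module.End.mul_apply, hu', hp, map_zero]
    simpa using this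
  rw [linearIndependent_iff']
  intro s g hg i hi
  have hterm : ∀ a ∈ s, aeval T (∏ b ∈ s, (X - C b)) (g a • R a v)
      = aeval T (C (g a) * ∏ b ∈ s.erase a, (X - C b)) v := by
    intro a ha
    have h1 : aeval T (X - C a) * R a = 1 := by simpa using hR a
    rw [← Finset.prod_erase_mul s _ ha, map_mul, map_mul, Module.End.mul_apply, map_smul,
      ← Module.End.mul_apply (aeval T (X - C a)), h1, aeval_C, Module.End.mul_apply,
      Module.algebraMap_end_apply, Module.End.one_apply, map_smul]
  have h2 := key (∑ a ∈ s, C (g a) * ∏ b ∈ s.erase a, (X - C b)) (by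
    rw [map_sum, LinearMap.sum_apply, ← Finset.sum_congr rfl hterm, ← map_sum, hg, map_zero])
  have h3 := congrArg (eval i) h2
  rw [eval_finsetSum, Finset.sum_eq_single i] at h3
  · simp only [eval_mul, eval_C, eval_prod, eval_sub, eval_X, eval_zero, mul_eq_zero] at h3
    refine h3.resolve_right (Finset.prod_ne_zero_iff.mpr fun b hb => ?_)
    exact sub_ne_zero.mpr (Finset.ne_of_mem_erase hb).symm
  · intro a _ hai
    rw [eval_mul, eval_prod, Finset.prod_eq_zero (i := i), mul_zero]
    · exact Finset.mem_erase.mpr ⟨hai.symm, hi⟩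
    · simp
  · exact fun h => absurd hi h

/-- An operator on a nonzero complex space of countable dimension has nonempty spectrum: the
vectors `(T - a)⁻¹ v` cannot be linearly independent for uncountably many `a`. -/
theorem exists_not_isUnit_sub_algebraMap [Module ℂ V] [Nontrivial V] {ι : Type*} [Countable ι]
    (b : ι → V) (hb : Submodule.span ℂ (Set.range b) = ⊤) (T : Module.End ℂ V) :
    ∃ a : ℂ, ¬ IsUnit (T - algebraMap ℂ _ a) := by
  by_contra! hu
  obtain ⟨v, hv⟩ := exists_ne (0 : V)
  have hR := linearIndependent_resolvent T (fun a => (hu a).unit⁻¹.1)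
    (fun a => (hu a).mul_val_inv) hu hv
  have h1 := hR.cardinal_lift_le_rank
  have h2 : Module.rank ℂ V ≤ Cardinal.aleph0 := by
    rw [← rank_top, ← hb]
    exact (rank_span_le _).trans (Set.countable_range b).le_aleph0
  have h3 : Cardinal.lift.{0} (Module.rank ℂ V) ≤ Cardinal.lift.{0} Cardinal.aleph0 :=
    Cardinal.lift_le.mpr h2
  have h4 := h1.trans h3
  rw [Cardinal.mk_complex, Cardinal.lift_continuum, Cardinal.lift_aleph0] at h4
  exact absurd h4 (not_le.mpr Cardinal.aleph0_lt_continuum)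

end Resolvent

noncomputable section

namespace Schrodinger

theorem eq_sum_basis (x : Schrodinger) :
    x = x.e • E + x.h • H + x.f • F + x.p • P + x.q • Q + x.z • Z := by
  ext <;> simp [E, H, F, P, Q, Z]

/-! ### The action of `SL₂` on the Schrödinger algebra -/

/-- The automorphism of the Schrödinger algebra given by a matrix of determinant one acting on the
plane spanned by `p` and `q`: it sends `p` to `α p + β q` and `q` to `γ p + δ q`, and acts on
`e, h, f` as on the quadratic forms `p²/2, -pq, -q²/2`. -/
def rotate (α β γ δ : ℂ) (hdet : α * δ - β * γ = 1) : Schrodinger →ₗ⁅ℂ⁆ Schrodinger where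
  toFun x :=
    { e := α ^ 2 * x.e - γ ^ 2 * x.f - 2 * (α * γ) * x.h
      h := -(α * β) * x.e + γ * δ * x.f + (α * δ + β * γ) * x.h
      f := -β ^ 2 * x.e + δ ^ 2 * x.f + 2 * (β * δ) * x.h
      p := α * x.p + γ * x.q
      q := β * x.p + δ * x.q
      z := x.z }
  map_add' x y := by ext <;> simp <;> ring
  map_smul' c x := by ext <;> simp <;> ring
  map_lie' := by
    intro x y
    -- each coordinate of the bracket of the images is the determinant times the expected one
    ext
    · simp only [lie_e, lie_f, lie_h]
      linear_combination (norm := (simp only [lie_e, lie_f, lie_h]; ring))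
        (-(α ^ 2 * ⁅x, y⁆.e - γ ^ 2 * ⁅x, y⁆.f - 2 * (α * γ) * ⁅x, y⁆.h)) * hdet
    · simp only [lie_e, lie_f, lie_h]
      linear_combination (norm := (simp only [lie_e, lie_f, lie_h]; ring))
        (-(-(α * β) * ⁅x, y⁆.e + γ * δ * ⁅x, y⁆.f + (α * δ + β * γ) * ⁅x, y⁆.h)) * hdet
    · simp only [lie_e, lie_f, lie_h]
      linear_combination (norm := (simp only [lie_e, lie_f, lie_h]; ring))
        (-(-β ^ 2 * ⁅x, y⁆.e + δ ^ 2 * ⁅x, y⁆.f + 2 * (β * δ) * ⁅x, y⁆.h)) * hdet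
    · simp only [lie_p, lie_q]
      linear_combination (norm := (simp only [lie_p, lie_q]; ring))
        (-(α * ⁅x, y⁆.p + γ * ⁅x, y⁆.q)) * hdet
    · simp only [lie_p, lie_q]
      linear_combination (norm := (simp only [lie_p, lie_q]; ring))
        (-(β * ⁅x, y⁆.p + δ * ⁅x, y⁆.q)) * hdet
    · simp only [lie_z]
      linear_combination (norm := (simp only [lie_z]; ring))
        (-⁅x, y⁆.z) * hdet

/-- The inverse matrix gives the inverse automorphism. -/
theorem rotate_rotate_inv (α β γ δ : ℂ) (hdet : α * δ - β * γ = 1)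
    (hdet' : δ * α - -β * -γ = 1) (x : Schrodinger) :
    rotate α β γ δ hdet (rotate δ (-β) (-γ) α hdet' x) = x := by
  have h2 : (α * δ - β * γ) ^ 2 = 1 := by rw [hdet, one_pow]
  ext <;> simp only [rotate, LieHom.coe_mk]
  · linear_combination x.e * h2
  · linear_combination x.h * h2
  · linear_combination x.f * h2
  · linear_combination x.p * hdet
  · linear_combination x.q * hdet

end Schrodinger

/-! ### The polynomial model -/

section PolynomialModel

open Polynomial
open Schrodinger hiding C

/-- The space `ℂ[Y][X]` of the polynomial model; `X ^ i * Y ^ j` stands for `eⁱ hʲ w`. -/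
abbrev SchrodingerModel : Type := ℂ[X][X]

namespace SchrodingerModel

/-- The substitution `Y ↦ Y + c`. -/
def shift (c : ℂ) : SchrodingerModel →ₐ[ℂ] SchrodingerModel := mapAlgHom (taylorAlgHom c)

@[simp] theorem shift_X (c : ℂ) : shift c X = X := by simp [shift]

@[simp] theorem shift_C (c : ℂ) (g : ℂ[X]) : shift c (C g) = C (taylor c g) := by simp [shift]

@[simp] theorem shift_shift (c d : ℂ) (G : SchrodingerModel) : shift c (shift d G) = shift (c + d) G := by
  ext1 n
  simp [shift, taylor_taylor]

@[simp] theorem shift_zero (G : SchrodingerModel) : shift 0 G = G := by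
  ext1 n
  simp [shift]

@[simp] theorem derivative_shift (c : ℂ) (G : SchrodingerModel) :
    derivative (shift c G) = shift c (derivative G) := by
  simp [shift, derivative_map]

theorem shift_eq_zero {c : ℂ} {G : SchrodingerModel} : shift c G = 0 ↔ G = 0 := by
  refine ⟨fun h => ?_, fun h => by rw [h, map_zero]⟩
  have := congrArg (shift (-c)) h
  simpa using this

theorem natDegree_shift (c : ℂ) (G : SchrodingerModel) : (shift c G).natDegree = G.natDegree :=
  natDegree_map_eq_of_injective (taylor_injective c) G

/-- Multiplication by `X`, the action of `e` on the model. -/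
def opE : Module.End ℂ SchrodingerModel := LinearMap.mulLeft ℂ X

/-- `∂/∂X`, as a `ℂ`-linear map. -/
def opD : Module.End ℂ SchrodingerModel :=
  (derivative : SchrodingerModel →ₗ[ℂ[X]] SchrodingerModel).restrictScalars ℂ

/-- The operator `Y + 2X ∂/∂X`, the action of `h` on the model. -/
def opH : Module.End ℂ SchrodingerModel :=
  LinearMap.mulLeft ℂ (C X) + (2 : ℂ) • LinearMap.mulLeft ℂ X * opD

/-- The operator `ξ T₂ - Y ∂/∂X - X (∂/∂X)²`, the action of `f` on the model; `T₂` is the shift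
`Y ↦ Y + 2`. -/
def opF (ξ : ℂ) : Module.End ℂ SchrodingerModel :=
  ξ • (shift 2).toLinearMap - LinearMap.mulLeft ℂ (C X) * opD - LinearMap.mulLeft ℂ X * opD * opD

/-- The shift `Y ↦ Y - 1`, the action of `p` on the model. -/
def opP : Module.End ℂ SchrodingerModel := (shift (-1)).toLinearMap

/-- The operator `-∂/∂X T₋₁`, the action of `q` on the model; `T₋₁` is the shift `Y ↦ Y - 1`. -/
def opQ : Module.End ℂ SchrodingerModel := -(opD * (shift (-1)).toLinearMap)

theorem opE_apply (G : SchrodingerModel) : opE G = X * G := rfl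
theorem opH_apply (G : SchrodingerModel) : opH G = C X * G + (2 : ℂ) • (X * derivative G) := rfl
theorem opF_apply (ξ : ℂ) (G : SchrodingerModel) :
    opF ξ G = ξ • shift 2 G - C X * derivative G - X * derivative (derivative G) := rfl
theorem opP_apply (G : SchrodingerModel) : opP G = shift (-1) G := rfl
theorem opQ_apply (G : SchrodingerModel) : opQ G = -shift (-1) (derivative G) := by
  rw [← derivative_shift]; rfl

/-- The action of the Schrödinger algebra on `ℂ[Y][X]` in which the constant polynomial `1` is a
quasi-Whittaker vector with `p 1 = 1`, `q 1 = 0` and `f 1 = ξ`. The operators are read off from the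
commutation rules applied to `eⁱ hʲ w`. -/
def rep (ξ : ℂ) : Schrodinger →ₗ⁅ℂ⁆ Module.End ℂ SchrodingerModel where
  toFun x := x.e • opE + x.h • opH + x.f • opF ξ + x.p • opP + x.q • opQ
  map_add' x y := by simp only [add_e, add_h, add_f, add_p, add_q]; module
  map_smul' c x := by
    simp only [smul_e, smul_h, smul_f, smul_p, smul_q, RingHom.id_apply]; module
  map_lie' := by
    intro x y
    refine LinearMap.ext fun G => ?_
    -- all terms are shifts of derivatives of `G` with polynomial coefficients
    have hC : ∀ c : ℂ, (algebraMap ℂ SchrodingerModel) c = C (C c) := fun c => rfl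
    simp only [LieRing.of_associative_ring_bracket, LinearMap.add_apply, LinearMap.sub_apply,
      LinearMap.smul_apply, Module.End.mul_apply, map_add, map_smul, opE_apply, opH_apply,
      opF_apply, opP_apply, opQ_apply, map_sub, map_neg, map_mul, shift_X, shift_C, shift_shift,
      derivative_shift, derivative_mul, derivative_X, derivative_C, derivative_one, taylor_X,
      lie_e, lie_h, lie_f, lie_p, lie_q]
    norm_num
    simp only [Algebra.smul_def, hC, C_add, C_mul, C_sub, map_ofNat]
    ring

theorem rep_E (ξ : ℂ) : rep ξ E = opE := by simp [rep, E]
theorem rep_H (ξ : ℂ) : rep ξ H = opH := by simp [rep, H]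
theorem rep_F (ξ : ℂ) : rep ξ F = opF ξ := by simp [rep, F]
theorem rep_P (ξ : ℂ) : rep ξ P = opP := by simp [rep, P]
theorem rep_Q (ξ : ℂ) : rep ξ Q = opQ := by simp [rep, Q]
theorem rep_Z (ξ : ℂ) : rep ξ Z = 0 := by simp [rep, Z]

/-! ### Simplicity of the model -/

/-- A subspace of `ℂ[Y][X]` stable under `e` and containing `ℂ[Y]` is everything. -/
theorem eq_top_of_C_mem {K : Submodule ℂ SchrodingerModel} (hC : ∀ g : ℂ[X], C g ∈ K)
    (hE : ∀ G ∈ K, opE G ∈ K) : K = ⊤ := by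
  refine Submodule.eq_top_iff'.mpr fun G => ?_
  induction G using Polynomial.induction_on' with
  | add p q hp hq => exact K.add_mem hp hq
  | monomial n g =>
    rw [← C_mul_X_pow_eq_monomial]
    induction n with
    | zero => simpa using hC g
    | succ n ih =>
      have := hE _ ih
      rwa [opE_apply, mul_comm, mul_assoc, ← pow_succ] at this

/-- The vector `1` generates `ℂ[Y][X]` under `e` and `h`. -/
theorem eq_top_of_one_mem {K : Submodule ℂ SchrodingerModel} (h1 : 1 ∈ K) (hE : ∀ G ∈ K, opE G ∈ K)
    (hH : ∀ G ∈ K, opH G ∈ K) : K = ⊤ := by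
  refine eq_top_of_C_mem (fun g => ?_) hE
  induction g using Polynomial.induction_on' with
  | add p q hp hq => rw [C_add]; exact K.add_mem hp hq
  | monomial n c =>
    have hn : C (X ^ n : ℂ[X]) ∈ K := by
      induction n with
      | zero => simpa using h1
      | succ n ih =>
        have := hH _ ih
        rwa [opH_apply, derivative_C, mul_zero, smul_zero, add_zero, ← C_mul, ← pow_succ'] at this
    have := K.smul_mem c hn
    rwa [smul_C, smul_X_eq_monomial] at this

/-- A nonzero subspace stable under `q` meets `ℂ[Y]`, since `q` lowers the degree in `X`. -/
theorem exists_C_mem {K : Submodule ℂ SchrodingerModel} (hQ : ∀ G ∈ K, opQ G ∈ K) (hK : K ≠ ⊥) :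
    ∃ g : ℂ[X], g ≠ 0 ∧ C g ∈ K := by
  obtain ⟨G, hG, hG0⟩ := K.ne_bot_iff.mp hK
  induction hn : G.natDegree using Nat.strong_induction_on generalizing G with
  | _ n ih =>
    by_cases h0 : G.natDegree = 0
    · rw [eq_C_of_natDegree_eq_zero h0] at hG hG0
      exact ⟨_, fun h => hG0 (by rw [h, C_0]), hG⟩
    · have hd : derivative G ≠ 0 := fun h => h0 (derivative_eq_zero.mp h)
      refine ih (opQ G).natDegree ?_ (opQ G) (hQ G hG) ?_ rfl
      · rw [opQ_apply, natDegree_neg, natDegree_shift, ← hn]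
        exact natDegree_derivative_lt h0
      · rw [opQ_apply, neg_ne_zero]
        exact fun h => hd (shift_eq_zero.mp h)

/-- A polynomial invariant under a nonzero shift is periodic, hence constant. -/
theorem eq_C_of_taylor_eq {g : ℂ[X]} (h : taylor (-1) g = g) : g = C (g.eval 0) := by
  have hn : ∀ n : ℕ, g.eval (n : ℂ) = g.eval 0 := by
    intro n
    induction n with
    | zero => simp
    | succ n ih =>
      rw [← ih]
      conv_lhs => rw [← h]
      rw [taylor_eval]
      simp
  refine Polynomial.eq_of_infinite_eval_eq _ _
    ((Set.infinite_range_of_injective (Nat.cast_injective (R := ℂ))).mono ?_)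
  rintro _ ⟨n, rfl⟩
  simp [hn n]

/-- The difference operator `p - 1` lowers the degree in `Y`. -/
theorem one_mem {K : Submodule ℂ SchrodingerModel} (hP : ∀ G ∈ K, opP G ∈ K) {g : ℂ[X]} (hg0 : g ≠ 0)
    (hg : C g ∈ K) : 1 ∈ K := by
  induction hn : g.natDegree using Nat.strong_induction_on generalizing g with
  | _ n ih =>
    by_cases h : taylor (-1) g = g
    · rw [eq_C_of_taylor_eq h] at hg hg0
      have hc : g.eval 0 ≠ 0 := fun h => hg0 (by rw [h, C_0])
      have := K.smul_mem (g.eval 0)⁻¹ hg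
      simpa [smul_C, hc] using this
    · have hsub : C (taylor (-1) g - g) ∈ K := by
        have := K.sub_mem (hP _ hg) hg
        rwa [opP_apply, shift_C, ← C_sub] at this
      refine ih _ ?_ (sub_ne_zero.mpr h) hsub rfl
      rw [← hn, ← natDegree_taylor g (-1)]
      refine natDegree_lt_natDegree (sub_ne_zero.mpr h) (degree_sub_lt_left (degree_taylor _ _) ?_ ?_)
      · rwa [Ne, taylor_eq_zero]
      · exact leadingCoeff_taylor _ _

/-- The polynomial model is a simple module. -/
theorem eq_top_of_ne_bot {ξ : ℂ} {K : Submodule ℂ SchrodingerModel} (hK : ∀ x, ∀ G ∈ K, rep ξ x G ∈ K)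
    (h0 : K ≠ ⊥) : K = ⊤ := by
  have hE := hK E
  have hH := hK H
  have hP := hK P
  have hQ := hK Q
  rw [rep_E] at hE
  rw [rep_H] at hH
  rw [rep_P] at hP
  rw [rep_Q] at hQ
  obtain ⟨g, hg0, hg⟩ := exists_C_mem hQ h0
  exact eq_top_of_one_mem (one_mem hP hg0 hg) hE hH

end SchrodingerModel
end PolynomialModel

/-! ### Comparison of the model with a cyclic module -/

section Comparison

open Polynomial
open Schrodinger hiding C

namespace SchrodingerModel

variable {V : Type*} [AddCommGroup V] [Module ℂ V]

/-- The map `∑ Xⁱ gᵢ(Y) ↦ ∑ eⁱ gᵢ(h) v` from the polynomial model, for a representation `ρ`. -/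
def orbitMap (ρ : Schrodinger →ₗ⁅ℂ⁆ Module.End ℂ V) (v : V) : SchrodingerModel →ₗ[ℂ] V :=
  Polynomial.lsum fun i =>
    (ρ E ^ i) ∘ₗ (LinearMap.applyₗ v ∘ₗ (aeval (ρ H) : ℂ[X] →ₐ[ℂ] Module.End ℂ V).toLinearMap)

variable (ρ : Schrodinger →ₗ⁅ℂ⁆ Module.End ℂ V) (v : V)

theorem orbitMap_monomial (i : ℕ) (g : ℂ[X]) :
    orbitMap ρ v (monomial i g) = (ρ E ^ i) (aeval (ρ H) g v) := by
  simp [orbitMap, lsum_apply]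

theorem orbitMap_C (g : ℂ[X]) : orbitMap ρ v (C g) = aeval (ρ H) g v := by
  rw [← monomial_zero_left, orbitMap_monomial]
  simp

theorem orbitMap_one : orbitMap ρ v 1 = v := by
  rw [← C_1, orbitMap_C]
  simp

theorem orbitMap_opE (G : SchrodingerModel) : orbitMap ρ v (opE G) = ρ E (orbitMap ρ v G) := by
  induction G using Polynomial.induction_on' with
  | add p q hp hq => rw [map_add, map_add, hp, hq, map_add, map_add]
  | monomial n g =>
    rw [opE_apply, X_mul_monomial, orbitMap_monomial, orbitMap_monomial, pow_succ',
      Module.End.mul_apply]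

/-- If `x` intertwines on `G`, and a generator `y` intertwines everywhere, then `x` intertwines on
`y G` as soon as `⁅x, y⁆` does on `G`. -/
theorem orbitMap_rep_rep {ξ : ℂ} {x y : Schrodinger} {G : SchrodingerModel}
    (hy : ∀ G, orbitMap ρ v (rep ξ y G) = ρ y (orbitMap ρ v G))
    (hx : orbitMap ρ v (rep ξ x G) = ρ x (orbitMap ρ v G))
    (hxy : orbitMap ρ v (rep ξ ⁅x, y⁆ G) = ρ ⁅x, y⁆ (orbitMap ρ v G)) :
    orbitMap ρ v (rep ξ x (rep ξ y G)) = ρ x (orbitMap ρ v (rep ξ y G)) := by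
  have h1 : rep ξ x (rep ξ y G) = rep ξ ⁅x, y⁆ G + rep ξ y (rep ξ x G) := by
    rw [LieHom.map_lie, LieRing.of_associative_ring_bracket]
    simp
  have h2 : ρ x (ρ y (orbitMap ρ v G)) = ρ ⁅x, y⁆ (orbitMap ρ v G) + ρ y (ρ x (orbitMap ρ v G)) := by
    rw [LieHom.map_lie, LieRing.of_associative_ring_bracket]
    simp
  rw [h1, map_add, hxy, hy, hx, hy, h2]

theorem orbitMap_opH (ξ : ℂ) (G : SchrodingerModel) :
    orbitMap ρ v (opH G) = ρ H (orbitMap ρ v G) := by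
  have hE : ∀ G, orbitMap ρ v (rep ξ E G) = ρ E (orbitMap ρ v G) := by
    rw [rep_E]; exact orbitMap_opE ρ v
  let K : Submodule ℂ SchrodingerModel :=
    LinearMap.eqLocus (orbitMap ρ v ∘ₗ rep ξ H) (ρ H ∘ₗ orbitMap ρ v)
  have hK : K = ⊤ := by
    refine eq_top_of_C_mem (fun g => ?_) (fun G hG => ?_)
    · change orbitMap ρ v (rep ξ H (C g)) = ρ H (orbitMap ρ v (C g))
      rw [rep_H, opH_apply, derivative_C, mul_zero, smul_zero, add_zero, ← C_mul, orbitMap_C,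
        orbitMap_C, map_mul, aeval_X, Module.End.mul_apply]
    · have hG' : orbitMap ρ v (rep ξ H G) = ρ H (orbitMap ρ v G) := hG
      have hb : ⁅H, E⁆ = (2 : ℂ) • E := bracket_relations.1
      have := orbitMap_rep_rep ρ v hE hG' (by
        rw [hb, map_smul, map_smul, LinearMap.smul_apply, map_smul, hE, LinearMap.smul_apply])
      rw [rep_E] at this
      exact this
  have : G ∈ K := hK ▸ Submodule.mem_top
  rw [← rep_H ξ]
  exact this

/-- The orbit map of a vector `v` with `p v = v`, `q v = 0`, `z v = 0`, `f v = ξ v` is a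
homomorphism. -/
theorem orbitMap_rep {ξ : ℂ} {v : V} (hP : ρ P v = v) (hQ : ρ Q v = 0) (hZ : ρ Z v = 0)
    (hF : ρ F v = ξ • v) (x : Schrodinger) (G : SchrodingerModel) :
    orbitMap ρ v (rep ξ x G) = ρ x (orbitMap ρ v G) := by
  have hE : ∀ G, orbitMap ρ v (rep ξ E G) = ρ E (orbitMap ρ v G) := by
    rw [rep_E]; exact orbitMap_opE ρ v
  have hH : ∀ G, orbitMap ρ v (rep ξ H G) = ρ H (orbitMap ρ v G) := by
    rw [rep_H]; exact orbitMap_opH ρ v ξ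
  let K : Submodule ℂ SchrodingerModel :=
    ⨅ x, LinearMap.eqLocus (orbitMap ρ v ∘ₗ rep ξ x) (ρ x ∘ₗ orbitMap ρ v)
  have hmem : ∀ G, G ∈ K ↔ ∀ x, orbitMap ρ v (rep ξ x G) = ρ x (orbitMap ρ v G) := by
    intro G
    simp [K, Submodule.mem_iInf]
  have hK : K = ⊤ := by
    refine eq_top_of_one_mem ?_ (fun G hG => ?_) (fun G hG => ?_)
    · rw [hmem]
      intro x
      have hF' : rep ξ F 1 = ξ • 1 := by simp [rep_F, opF_apply]
      have hP' : rep ξ P 1 = 1 := by simp [rep_P, opP_apply]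
      have hQ' : rep ξ Q 1 = 0 := by simp [rep_Q, opQ_apply]
      rw [eq_sum_basis x]
      simp only [map_add, map_smul, LinearMap.add_apply, LinearMap.smul_apply, hE, hH, hF', hP',
        hQ', rep_Z, orbitMap_one, LinearMap.zero_apply, map_zero, hP, hQ, hZ, hF]
    · rw [← rep_E ξ, hmem]
      rw [hmem] at hG
      exact fun x => orbitMap_rep_rep ρ v hE (hG x) (hG _)
    · rw [← rep_H ξ, hmem]
      rw [hmem] at hG
      exact fun x => orbitMap_rep_rep ρ v hH (hG x) (hG _)
  have : G ∈ K := hK ▸ Submodule.mem_top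
  exact (hmem G).mp this x

end SchrodingerModel

end Comparison

/-! ### Modules generated by a quasi-Whittaker vector -/

namespace Schrodinger

variable {V : Type*} [AddCommGroup V] [Module ℂ V] [LieRingModule Schrodinger V]
  [LieModule ℂ Schrodinger V]

/-- `z` as an element of the Heisenberg subalgebra. -/
def heisenbergZ : heisenberg := ⟨Z, Submodule.subset_span (by simp)⟩

/-- A homomorphism from the Heisenberg algebra to `ℂ` vanishes at `z = ⁅p, q⁆`. -/
theorem map_heisenbergZ (φ : heisenberg →ₗ⁅ℂ⁆ ℂ) : φ heisenbergZ = 0 := by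
  have : heisenbergZ = ⁅heisenbergP, heisenbergQ⁆ :=
    Subtype.ext bracket_relations.2.2.2.2.2.1.symm
  rw [this, LieHom.map_lie, LieRing.of_associative_ring_bracket, mul_comm, sub_self]

theorem lie_Z_of_isQuasiWhittakerVector {V : Type*} [AddCommGroup V] [Module ℂ V]
    [LieRingModule Schrodinger V] {φ : heisenberg →ₗ⁅ℂ⁆ ℂ} {v : V}
    (hv : IsQuasiWhittakerVector φ v) : ⁅Z, v⁆ = 0 := by
  have := hv.2 heisenbergZ
  rwa [map_heisenbergZ, zero_smul] at this

/-- The element `φ(p)² f - φ(q)² e - φ(p) φ(q) h` of the Schrödinger algebra, whose image in the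
enveloping algebra is `C`. -/
def lieC (φ : heisenberg →ₗ⁅ℂ⁆ ℂ) : Schrodinger :=
  φ heisenbergP ^ 2 • F - φ heisenbergQ ^ 2 • E - (φ heisenbergP * φ heisenbergQ) • H

/-- For `φ ≠ 0` there is an automorphism `σ` of the Schrödinger algebra moving `φ` to the
functional with `p ↦ 1`, `q ↦ 0`; then `σ f` is the element `C`. -/
theorem exists_automorphism (φ : heisenberg →ₗ⁅ℂ⁆ ℂ)
    (hφ : φ heisenbergP ≠ 0 ∨ φ heisenbergQ ≠ 0) :
    ∃ σ : Schrodinger →ₗ⁅ℂ⁆ Schrodinger, Function.Bijective σ ∧ σ F = lieC φ ∧ σ Z = Z ∧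
      (∃ α β : ℂ, α * φ heisenbergP + β * φ heisenbergQ = 1 ∧ σ P = α • P + β • Q) ∧
      σ Q = φ heisenbergP • Q - φ heisenbergQ • P := by
  obtain ⟨α, β, h⟩ : ∃ α β : ℂ, α * φ heisenbergP + β * φ heisenbergQ = 1 := by
    rcases hφ with h | h
    · exact ⟨(φ heisenbergP)⁻¹, 0, by field_simp; ring⟩
    · exact ⟨0, (φ heisenbergQ)⁻¹, by field_simp; ring⟩
  have hdet : α * φ heisenbergP - β * -φ heisenbergQ = 1 := by linear_combination h
  have hdet' : φ heisenbergP * α - -β * - -φ heisenbergQ = 1 := by linear_combination h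
  refine ⟨rotate α β (-φ heisenbergQ) (φ heisenbergP) hdet, ⟨?_, ?_⟩, ?_, ?_, ⟨α, β, h, ?_⟩, ?_⟩
  · have hdet'' : α * φ heisenbergP - - -β * - - -φ heisenbergQ = 1 := by linear_combination h
    have := rotate_rotate_inv _ _ _ _ hdet' hdet''
    simp only [neg_neg] at this
    exact Function.LeftInverse.injective this
  · exact Function.RightInverse.surjective (rotate_rotate_inv _ _ _ _ hdet hdet')
  all_goals ext <;> simp [rotate, lieC, sub_eq_add_neg, E, H, F, P, Q, Z, mul_comm]

/-- A module generated by a quasi-Whittaker vector on which `C` acts by `ξ` is the polynomial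
model, up to the automorphism `σ`. -/
theorem exists_model_equiv {φ : heisenberg →ₗ⁅ℂ⁆ ℂ} {ξ : ℂ} {v : V}
    (hv : IsQuasiWhittakerVector φ v) (hC : ⁅lieC φ, v⁆ = ξ • v)
    (hgen : LieSubmodule.lieSpan ℂ Schrodinger {v} = ⊤)
    {σ : Schrodinger →ₗ⁅ℂ⁆ Schrodinger} (hσ : Function.Surjective σ) (hσF : σ F = lieC φ)
    (hσZ : σ Z = Z)
    (hσP : ∃ α β : ℂ, α * φ heisenbergP + β * φ heisenbergQ = 1 ∧ σ P = α • P + β • Q)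
    (hσQ : σ Q = φ heisenbergP • Q - φ heisenbergQ • P) :
    ∃ ψ : SchrodingerModel ≃ₗ[ℂ] V,
      ∀ x G, ψ (SchrodingerModel.rep ξ x G) = ⁅σ x, ψ G⁆ := by
  have hPv : ⁅P, v⁆ = φ heisenbergP • v := hv.2 heisenbergP
  have hQv : ⁅Q, v⁆ = φ heisenbergQ • v := hv.2 heisenbergQ
  let ρ : Schrodinger →ₗ⁅ℂ⁆ Module.End ℂ V := (LieModule.toEnd ℂ Schrodinger V).comp σ
  have hρ : ∀ x u, ρ x u = ⁅σ x, u⁆ := fun _ _ => rfl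
  have hrep : ∀ x G, SchrodingerModel.orbitMap ρ v (SchrodingerModel.rep ξ x G)
      = ⁅σ x, SchrodingerModel.orbitMap ρ v G⁆ := by
    refine SchrodingerModel.orbitMap_rep ρ ?_ ?_ ?_ ?_
    · obtain ⟨α, β, h, hσP⟩ := hσP
      rw [hρ, hσP, add_lie, smul_lie, smul_lie, hPv, hQv, smul_smul, smul_smul, ← add_smul, h,
        one_smul]
    · rw [hρ, hσQ, sub_lie, smul_lie, smul_lie, hPv, hQv, smul_smul, smul_smul, mul_comm, sub_self]
    · rw [hρ, hσZ, lie_Z_of_isQuasiWhittakerVector hv]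
    · rw [hρ, hσF, hC]
  refine ⟨LinearEquiv.ofBijective (SchrodingerModel.orbitMap ρ v) ⟨?_, ?_⟩, hrep⟩
  · rw [← LinearMap.ker_eq_bot]
    by_contra hker
    have htop := SchrodingerModel.eq_top_of_ne_bot (ξ := ξ) (fun x G hG => by
      rw [LinearMap.mem_ker] at hG ⊢
      rw [hrep, hG, lie_zero]) hker
    have h1 : (1 : SchrodingerModel) ∈ LinearMap.ker (SchrodingerModel.orbitMap ρ v) :=
      htop ▸ Submodule.mem_top
    rw [LinearMap.mem_ker, SchrodingerModel.orbitMap_one] at h1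
    exact hv.1 h1
  · let N : LieSubmodule ℂ Schrodinger V :=
      { LinearMap.range (SchrodingerModel.orbitMap ρ v) with
        lie_mem := by
          rintro x _ ⟨G, rfl⟩
          obtain ⟨y, rfl⟩ := hσ x
          exact ⟨SchrodingerModel.rep ξ y G, hrep y G⟩ }
    have hN : LieSubmodule.lieSpan ℂ Schrodinger {v} ≤ N :=
      LieSubmodule.lieSpan_le.mpr (Set.singleton_subset_iff.mpr
        ⟨1, SchrodingerModel.orbitMap_one ρ v⟩)
    intro u
    exact hN (hgen ▸ LieSubmodule.mem_top u)

/-- A module generated by a quasi-Whittaker vector on which `C` acts by a scalar is simple. -/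
theorem isIrreducible_of_lieC {φ : heisenberg →ₗ⁅ℂ⁆ ℂ}
    (hφ : φ heisenbergP ≠ 0 ∨ φ heisenbergQ ≠ 0) {ξ : ℂ} {v : V}
    (hv : IsQuasiWhittakerVector φ v) (hC : ⁅lieC φ, v⁆ = ξ • v)
    (hgen : LieSubmodule.lieSpan ℂ Schrodinger {v} = ⊤) :
    LieModule.IsIrreducible ℂ Schrodinger V := by
  obtain ⟨σ, hσ, hσF, hσZ, hσP, hσQ⟩ := exists_automorphism φ hφ
  obtain ⟨ψ, hψ⟩ := exists_model_equiv hv hC hgen hσ.2 hσF hσZ hσP hσQ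
  have : Nontrivial V := ⟨v, 0, hv.1⟩
  refine LieModule.IsIrreducible.mk fun N hN => ?_
  have htop := SchrodingerModel.eq_top_of_ne_bot (ξ := ξ) (K := N.toSubmodule.comap ψ.toLinearMap)
    (fun x G hG => by
      change ψ _ ∈ N
      rw [hψ]
      exact N.lie_mem hG) (fun h => hN (by
      rw [LieSubmodule.eq_bot_iff]
      intro u hu
      have : ψ.symm u ∈ N.toSubmodule.comap ψ.toLinearMap := by simpa using hu
      rw [h, Submodule.mem_bot] at this
      simpa using this))
  refine eq_top_iff.mpr fun u _ => ?_
  have : ψ.symm u ∈ N.toSubmodule.comap ψ.toLinearMap := htop ▸ Submodule.mem_top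
  simpa using this

/-- Two modules generated by a quasi-Whittaker vector of the same type on which `C` acts by the same
scalar are isomorphic. -/
theorem nonempty_equiv_of_lieC {V' : Type*} [AddCommGroup V'] [Module ℂ V']
    [LieRingModule Schrodinger V'] [LieModule ℂ Schrodinger V'] {φ : heisenberg →ₗ⁅ℂ⁆ ℂ}
    (hφ : φ heisenbergP ≠ 0 ∨ φ heisenbergQ ≠ 0) {ξ : ℂ} {v : V}
    (hv : IsQuasiWhittakerVector φ v) (hC : ⁅lieC φ, v⁆ = ξ • v)
    (hgen : LieSubmodule.lieSpan ℂ Schrodinger {v} = ⊤) {v' : V'}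
    (hv' : IsQuasiWhittakerVector φ v') (hC' : ⁅lieC φ, v'⁆ = ξ • v')
    (hgen' : LieSubmodule.lieSpan ℂ Schrodinger {v'} = ⊤) :
    Nonempty (V ≃ₗ⁅ℂ, Schrodinger⁆ V') := by
  obtain ⟨σ, hσ, hσF, hσZ, hσP, hσQ⟩ := exists_automorphism φ hφ
  obtain ⟨ψ, hψ⟩ := exists_model_equiv hv hC hgen hσ.2 hσF hσZ hσP hσQ
  obtain ⟨ψ', hψ'⟩ := exists_model_equiv hv' hC' hgen' hσ.2 hσF hσZ hσP hσQ
  refine ⟨{ ψ.symm.trans ψ' with map_lie' := fun {x u} => ?_ }⟩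
  obtain ⟨y, rfl⟩ := hσ.2 x
  obtain ⟨G, rfl⟩ := ψ.surjective u
  change ψ' (ψ.symm ⁅σ y, ψ G⁆) = ⁅σ y, ψ' (ψ.symm (ψ G))⁆
  rw [← hψ, ψ.symm_apply_apply, ψ.symm_apply_apply, hψ']

/-! ### The element `C₀` -/

section CommutationRules

variable {V : Type*} [AddCommGroup V] [LieRingModule Schrodinger V]

theorem lie_P_lie_E (u : V) : ⁅P, ⁅E, u⁆⁆ = ⁅E, ⁅P, u⁆⁆ := by
  rw [leibniz_lie, ← lie_skew P E, bracket_relations.2.2.2.2.2.2.2.2.2.1]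
  simp

theorem lie_P_lie_H (u : V) : ⁅P, ⁅H, u⁆⁆ = ⁅H, ⁅P, u⁆⁆ - ⁅P, u⁆ := by
  rw [leibniz_lie, ← lie_skew P H, bracket_relations.2.2.2.1, neg_lie]
  abel

theorem lie_P_lie_F (u : V) : ⁅P, ⁅F, u⁆⁆ = ⁅F, ⁅P, u⁆⁆ - ⁅Q, u⁆ := by
  rw [leibniz_lie, bracket_relations.2.2.2.2.2.2.2.1, neg_lie]
  abel

theorem lie_Q_lie_E (u : V) : ⁅Q, ⁅E, u⁆⁆ = ⁅E, ⁅Q, u⁆⁆ - ⁅P, u⁆ := by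
  rw [leibniz_lie, ← lie_skew Q E, bracket_relations.2.2.2.2.2.2.1, neg_lie]
  abel

theorem lie_Q_lie_H (u : V) : ⁅Q, ⁅H, u⁆⁆ = ⁅H, ⁅Q, u⁆⁆ + ⁅Q, u⁆ := by
  rw [leibniz_lie, ← lie_skew Q H, bracket_relations.2.2.2.2.1, neg_neg]
  abel

theorem lie_Q_lie_F (u : V) : ⁅Q, ⁅F, u⁆⁆ = ⁅F, ⁅Q, u⁆⁆ := by
  rw [leibniz_lie, ← lie_skew Q F, bracket_relations.2.2.2.2.2.2.2.2.1]
  simp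

theorem lie_H_lie_E [Module ℂ V] [LieModule ℂ Schrodinger V] (u : V) :
    ⁅H, ⁅E, u⁆⁆ = ⁅E, ⁅H, u⁆⁆ + (2 : ℂ) • ⁅E, u⁆ := by
  rw [leibniz_lie, bracket_relations.1, smul_lie]
  abel

theorem lie_F_lie_E (u : V) : ⁅F, ⁅E, u⁆⁆ = ⁅E, ⁅F, u⁆⁆ - ⁅H, u⁆ := by
  rw [leibniz_lie, ← lie_skew F E, bracket_relations.2.2.1, neg_lie]
  abel

theorem lie_F_lie_H [Module ℂ V] [LieModule ℂ Schrodinger V] (u : V) :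
    ⁅F, ⁅H, u⁆⁆ = ⁅H, ⁅F, u⁆⁆ + (2 : ℂ) • ⁅F, u⁆ := by
  rw [leibniz_lie, ← lie_skew F H, bracket_relations.2.1, neg_lie, smul_lie]
  module

theorem lie_Q_lie_P (hZ : ∀ u : V, ⁅Z, u⁆ = 0) (u : V) : ⁅Q, ⁅P, u⁆⁆ = ⁅P, ⁅Q, u⁆⁆ := by
  rw [leibniz_lie, ← lie_skew Q P, bracket_relations.2.2.2.2.2.1, neg_lie, hZ]
  simp

end CommutationRules

section CasimirElement

variable {V : Type*} [AddCommGroup V] [Module ℂ V] [LieRingModule Schrodinger V]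
  [LieModule ℂ Schrodinger V]

theorem actU_C₀_apply (v : V) :
    actU V C₀ v = ⁅P, ⁅P, ⁅F, v⁆⁆⁆ - ⁅Q, ⁅Q, ⁅E, v⁆⁆⁆ - ⁅H, ⁅P, ⁅Q, v⁆⁆⁆ := by
  have h : ∀ x, actU V (toU x) = LieModule.toEnd ℂ Schrodinger V x := fun x =>
    UniversalEnvelopingAlgebra.lift_ι_apply ℂ _ x
  simp only [C₀, map_sub, map_mul, h, LinearMap.sub_apply, Module.End.mul_apply, pow_two,
    LieModule.toEnd_apply_apply]

/-- `C₀` is central in `U(𝔖)` modulo `z`: both sides are brought to the order `e, h, f, p, q`. -/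
theorem actU_C₀_lie (hZ : ∀ u : V, ⁅Z, u⁆ = 0) (x : Schrodinger) (u : V) :
    actU V C₀ ⁅x, u⁆ = ⁅x, actU V C₀ u⁆ := by
  have h : ∀ y ∈ [E, H, F, P, Q], actU V C₀ ⁅y, u⁆ = ⁅y, actU V C₀ u⁆ := by
    simp only [List.forall_mem_cons, actU_C₀_apply, lie_P_lie_E, lie_P_lie_H, lie_P_lie_F,
      lie_Q_lie_E, lie_Q_lie_H, lie_Q_lie_F, lie_H_lie_E, lie_F_lie_E, lie_F_lie_H,
      lie_Q_lie_P hZ, lie_add, lie_sub]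
    refine ⟨?_, ?_, ?_, ?_, ?_, by simp⟩ <;> module
  simp only [List.forall_mem_cons] at h
  obtain ⟨hE, hH, hF, hP, hQ, -⟩ := h
  rw [eq_sum_basis x]
  simp only [add_lie, smul_lie, map_add, map_smul, hE, hH, hF, hP, hQ, hZ, map_zero]

/-- On a quasi-Whittaker vector, `C₀` and `C` act in the same way. -/
theorem actU_C₀_eq_lieC {φ : heisenberg →ₗ⁅ℂ⁆ ℂ} {v : V} (hv : IsQuasiWhittakerVector φ v) :
    actU V C₀ v = ⁅lieC φ, v⁆ := by
  have hPv : ⁅P, v⁆ = φ heisenbergP • v := hv.2 heisenbergP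
  have hQv : ⁅Q, v⁆ = φ heisenbergQ • v := hv.2 heisenbergQ
  simp only [actU_C₀_apply, lieC, lie_P_lie_F, lie_Q_lie_E, lie_sub, sub_lie, smul_lie,
    lie_smul, hPv, hQv]
  module

variable {φ : heisenberg →ₗ⁅ℂ⁆ ℂ} {v : V}

/-- The central element `z` kills a module generated by a quasi-Whittaker vector. -/
theorem lie_Z_eq_zero (hv : IsQuasiWhittakerVector φ v)
    (hgen : LieSubmodule.lieSpan ℂ Schrodinger {v} = ⊤) (u : V) : ⁅Z, u⁆ = 0 := by
  let N : LieSubmodule ℂ Schrodinger V :=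
    { LinearMap.ker (LieModule.toEnd ℂ Schrodinger V Z) with
      lie_mem := by
        intro x m hm
        change ⁅Z, ⁅x, m⁆⁆ = 0
        have hm' : ⁅Z, m⁆ = 0 := hm
        rw [leibniz_lie, bracket_relations.2.2.2.2.2.2.2.2.2.2, zero_lie, hm', lie_zero, add_zero] }
  have hN : LieSubmodule.lieSpan ℂ Schrodinger {v} ≤ N :=
    LieSubmodule.lieSpan_le.mpr (Set.singleton_subset_iff.mpr (lie_Z_of_isQuasiWhittakerVector hv))
  exact hN (hgen ▸ LieSubmodule.mem_top u)

/-- The kernel of an operator commuting with the action. -/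
def kerOfCommute (T : Module.End ℂ V) (hT : ∀ (x : Schrodinger) (u : V), T ⁅x, u⁆ = ⁅x, T u⁆) :
    LieSubmodule ℂ Schrodinger V :=
  { LinearMap.ker T with
    lie_mem := by
      intro x m hm
      have hm' : T m = 0 := hm
      change T ⁅x, m⁆ = 0
      rw [hT, hm', lie_zero] }

/-- The range of an operator commuting with the action. -/
def rangeOfCommute (T : Module.End ℂ V) (hT : ∀ (x : Schrodinger) (u : V), T ⁅x, u⁆ = ⁅x, T u⁆) :
    LieSubmodule ℂ Schrodinger V :=
  { LinearMap.range T with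
    lie_mem := by
      rintro x _ ⟨u, rfl⟩
      exact ⟨⁅x, u⁆, hT x u⟩ }

theorem sub_algebraMap_lie {T : Module.End ℂ V}
    (hT : ∀ (x : Schrodinger) (u : V), T ⁅x, u⁆ = ⁅x, T u⁆) (ξ : ℂ) (x : Schrodinger) (u : V) :
    (T - algebraMap ℂ _ ξ) ⁅x, u⁆ = ⁅x, (T - algebraMap ℂ _ ξ) u⁆ := by
  simp only [LinearMap.sub_apply, Module.algebraMap_end_apply, hT, lie_sub, lie_smul]

/-- As `C₀` commutes with the action, it acts by `ξ` everywhere if it does so on a generator. -/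
theorem c₀ActsBy_of_apply_eq (hv : IsQuasiWhittakerVector φ v)
    (hgen : LieSubmodule.lieSpan ℂ Schrodinger {v} = ⊤) {ξ : ℂ} (hC : ⁅lieC φ, v⁆ = ξ • v) :
    C₀ActsBy V ξ := by
  have hZ := lie_Z_eq_zero hv hgen
  have hN : LieSubmodule.lieSpan ℂ Schrodinger {v} ≤
      kerOfCommute _ (sub_algebraMap_lie (actU_C₀_lie hZ) ξ) := by
    refine LieSubmodule.lieSpan_le.mpr (Set.singleton_subset_iff.mpr ?_)
    change (actU V C₀ - algebraMap ℂ _ ξ) v = 0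
    rw [LinearMap.sub_apply, Module.algebraMap_end_apply, actU_C₀_eq_lieC hv, hC, sub_self]
  intro u
  have hu : (actU V C₀ - algebraMap ℂ _ ξ) u = 0 := hN (hgen ▸ LieSubmodule.mem_top u)
  rwa [LinearMap.sub_apply, Module.algebraMap_end_apply, sub_eq_zero] at hu

/-- A cyclic module has countable dimension: it is spanned by the words in the six basis vectors,
applied to the generator. -/
theorem exists_countable_spanning (hgen : LieSubmodule.lieSpan ℂ Schrodinger {v} = ⊤) :
    ∃ b : List (Fin 6) → V, Submodule.span ℂ (Set.range b) = ⊤ := by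
  let B : Fin 6 → Schrodinger := ![E, H, F, P, Q, Z]
  let b : List (Fin 6) → V := fun l => l.foldr (fun i u => ⁅B i, u⁆) v
  have hB : ∀ i, ∀ m ∈ Submodule.span ℂ (Set.range b), ⁅B i, m⁆ ∈ Submodule.span ℂ (Set.range b) := by
    intro i m hm
    induction hm using Submodule.span_induction with
    | mem u hu =>
      obtain ⟨l, rfl⟩ := hu
      exact Submodule.subset_span ⟨i :: l, rfl⟩
    | zero => rw [lie_zero]; exact Submodule.zero_mem _
    | add u u' _ _ hu hu' => rw [lie_add]; exact Submodule.add_mem _ hu hu'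
    | smul c u _ hu => rw [lie_smul]; exact Submodule.smul_mem _ c hu
  let N : LieSubmodule ℂ Schrodinger V :=
    { Submodule.span ℂ (Set.range b) with
      lie_mem := by
        intro x m hm
        change ⁅x, m⁆ ∈ Submodule.span ℂ (Set.range b)
        rw [eq_sum_basis x]
        simp only [add_lie, smul_lie]
        have h (i) (c : ℂ) := Submodule.smul_mem _ c (hB i m hm)
        exact add_mem (add_mem (add_mem (add_mem (add_mem (h 0 _) (h 1 _)) (h 2 _)) (h 3 _))
          (h 4 _)) (h 5 _) }
  have hN : LieSubmodule.lieSpan ℂ Schrodinger {v} ≤ N :=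
    LieSubmodule.lieSpan_le.mpr (Set.singleton_subset_iff.mpr (Submodule.subset_span ⟨[], rfl⟩))
  exact ⟨b, Submodule.eq_top_iff'.mpr fun u => hN (hgen ▸ LieSubmodule.mem_top u)⟩

/-- `C₀` acts by a scalar on a simple quasi-Whittaker module. -/
theorem exists_c₀ActsBy [LieModule.IsIrreducible ℂ Schrodinger V] (hv : IsQuasiWhittakerVector φ v)
    (hgen : LieSubmodule.lieSpan ℂ Schrodinger {v} = ⊤) : ∃ ξ : ℂ, C₀ActsBy V ξ := by
  have : Nontrivial V := ⟨v, 0, hv.1⟩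
  have hT := actU_C₀_lie (lie_Z_eq_zero hv hgen)
  obtain ⟨b, hb⟩ := exists_countable_spanning hgen
  obtain ⟨ξ, hξ⟩ := exists_not_isUnit_sub_algebraMap b hb (actU V C₀)
  refine ⟨ξ, ?_⟩
  set T := actU V C₀ - algebraMap ℂ _ ξ with hTdef
  have hT' : ∀ (x : Schrodinger) (u : V), T ⁅x, u⁆ = ⁅x, T u⁆ := sub_algebraMap_lie hT ξ
  have hzero : ∀ u, T u = 0 := by
    rcases eq_bot_or_eq_top (kerOfCommute T hT') with hk | hk
    · rcases eq_bot_or_eq_top (rangeOfCommute T hT') with hr | hr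
      · intro u
        have : T u ∈ rangeOfCommute T hT' := ⟨u, rfl⟩
        rwa [hr, LieSubmodule.mem_bot] at this
      · refine absurd ((Module.End.isUnit_iff T).mpr ⟨?_, fun u => ?_⟩) hξ
        · refine (injective_iff_map_eq_zero T).mpr fun u hu => ?_
          have : u ∈ kerOfCommute T hT' := hu
          rwa [hk, LieSubmodule.mem_bot] at this
        · have : u ∈ rangeOfCommute T hT' := hr ▸ LieSubmodule.mem_top u
          exact this
    · intro u
      have : u ∈ kerOfCommute T hT' := hk ▸ LieSubmodule.mem_top u
      exact this
  intro u
  have := hzero u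
  rwa [hTdef, LinearMap.sub_apply, Module.algebraMap_end_apply, sub_eq_zero] at this

theorem c₀ActsBy_congr {V' : Type*} [AddCommGroup V'] [Module ℂ V'] [LieRingModule Schrodinger V']
    [LieModule ℂ Schrodinger V'] {ξ : ℂ} (h : C₀ActsBy V ξ) (ψ : V' ≃ₗ⁅ℂ, Schrodinger⁆ V) :
    C₀ActsBy V' ξ := by
  intro u
  apply ψ.injective
  have hlie : ∀ (x : Schrodinger) (u : V'), ψ ⁅x, u⁆ = ⁅x, ψ u⁆ := fun x u =>
    LieModuleHom.map_lie ψ.toLieModuleHom x u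
  have hψ : ψ (actU V' C₀ u) = actU V C₀ (ψ u) := by
    have hsub : ∀ a b, ψ (a - b) = ψ a - ψ b := fun a b => map_sub ψ.toLieModuleHom a b
    simp only [actU_C₀_apply, hsub, hlie]
  rw [hψ, h]
  exact (map_smul ψ.toLieModuleHom ξ u).symm

end CasimirElement

end Schrodinger

/-! ### The modules `L_{φ,ξ}` -/

/-- The enveloping algebra is generated by the Lie algebra. -/
theorem UniversalEnvelopingAlgebra.eq_top_of_ι_mem {R 𝔤 : Type*} [CommRing R] [LieRing 𝔤]
    [LieAlgebra R 𝔤] (S : Subalgebra R (UniversalEnvelopingAlgebra R 𝔤))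
    (hS : ∀ x, UniversalEnvelopingAlgebra.ι R x ∈ S) : S = ⊤ := by
  let f : 𝔤 →ₗ⁅R⁆ S :=
    { toFun := fun x => ⟨UniversalEnvelopingAlgebra.ι R x, hS x⟩
      map_add' := fun x y => Subtype.ext (map_add _ x y)
      map_smul' := fun c x => Subtype.ext (map_smul (UniversalEnvelopingAlgebra.ι R) c x)
      map_lie' := fun {x y} => Subtype.ext (LieHom.map_lie _ x y) }
  have h : S.val.comp (UniversalEnvelopingAlgebra.lift R f) = AlgHom.id R _ := by
    refine UniversalEnvelopingAlgebra.hom_ext R (LieHom.ext fun x => ?_)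
    change S.val (UniversalEnvelopingAlgebra.lift R f (UniversalEnvelopingAlgebra.ι R x)) = _
    rw [UniversalEnvelopingAlgebra.lift_ι_apply]
    rfl
  refine Algebra.eq_top_iff.mpr fun u => ?_
  have hu := DFunLike.congr_fun h u
  rw [AlgHom.id_apply] at hu
  rw [← hu]
  exact (UniversalEnvelopingAlgebra.lift R f u).2

namespace Schrodinger

variable (φ : heisenberg →ₗ⁅ℂ⁆ ℂ)

theorem inclU_ι (x : heisenberg) :
    inclU (UniversalEnvelopingAlgebra.ι ℂ x) = toU (x : Schrodinger) :=
  UniversalEnvelopingAlgebra.lift_ι_apply ℂ _ x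

/-- The coordinate of a vector of `ℂ_φ` with respect to `w`. -/
def OneDim.coord : OneDim φ →ₗ[ℂ] ℂ := LinearMap.id (R := ℂ) (M := ℂ)

theorem OneDim.coord_w : OneDim.coord φ (OneDim.w φ) = 1 := rfl

theorem OneDim.coord_smul_w (c : OneDim φ) : OneDim.coord φ c • OneDim.w φ = c :=
  mul_one (OneDim.coord φ c)

theorem OneDim.coord_UH_smul (a : UH) (c : OneDim φ) :
    OneDim.coord φ (a • c) = UniversalEnvelopingAlgebra.lift ℂ φ a * OneDim.coord φ c := rfl

/-- The map `M_φ → R`, `w ↦ v`, before passing to the quotient by the balancing relations. -/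
def tensorLift {R : Type*} [AddCommGroup R] [Module ℂ R] (A : U →ₐ[ℂ] Module.End ℂ R) (v : R) :
    U ⊗[ℂ] OneDim φ →ₗ[ℂ] R :=
  TensorProduct.lift
    (LinearMap.mk₂ ℂ (fun (u : U) (c : OneDim φ) => A u (OneDim.coord φ c • v))
      (fun u u' c => by rw [map_add, LinearMap.add_apply])
      (fun a u c => by rw [map_smul A, LinearMap.smul_apply])
      (fun u c c' => by rw [map_add, add_smul, map_add])
      (fun a u c => by rw [map_smul (OneDim.coord φ), smul_assoc, map_smul]))

theorem tensorLift_tmul {R : Type*} [AddCommGroup R] [Module ℂ R] (A : U →ₐ[ℂ] Module.End ℂ R)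
    (v : R) (u : U) (c : OneDim φ) :
    tensorLift φ A v (u ⊗ₜ c) = A u (OneDim.coord φ c • v) := rfl

theorem tensorLift_smul {R : Type*} [AddCommGroup R] [Module ℂ R] (A : U →ₐ[ℂ] Module.End ℂ R)
    (v : R) (u : U) (t : U ⊗[ℂ] OneDim φ) :
    tensorLift φ A v (u • t) = A u (tensorLift φ A v t) := by
  induction t using TensorProduct.induction_on with
  | zero => rw [smul_zero, map_zero, map_zero]
  | add s t hs ht => rw [smul_add, map_add, hs, ht, map_add, map_add]
  | tmul u' c =>
    rw [TensorProduct.smul_tmul', smul_eq_mul, tensorLift_tmul, tensorLift_tmul, map_mul,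
      Module.End.mul_apply]

/-- The vector `w` of `L_{φ,ξ}` is nonzero as soon as some representation of `𝔖` has a nonzero
quasi-Whittaker vector on which `C` acts by `ξ`. -/
theorem w_notMem_W {R : Type*} [AddCommGroup R] [Module ℂ R] (A : U →ₐ[ℂ] Module.End ℂ R) {v : R}
    (hv0 : v ≠ 0) (hv : ∀ x : heisenberg, A (toU x) v = φ x • v) {ξ : ℂ}
    (hC : A (C φ) v = ξ • v) : M.w φ ∉ W φ ξ := by
  let K : Submodule U (U ⊗[ℂ] OneDim φ) :=
    { carrier := {t | tensorLift φ A v t = 0}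
      add_mem' := fun {s t} (hs : tensorLift φ A v s = 0) (ht : tensorLift φ A v t = 0) => by
        rw [Set.mem_ofPred_eq, map_add, hs, ht, add_zero]
      zero_mem' := map_zero _
      smul_mem' := fun u t (ht : tensorLift φ A v t = 0) => by
        rw [Set.mem_ofPred_eq, tensorLift_smul, ht, map_zero] }
  have hUH : ∀ a : UH, A (inclU a) v = UniversalEnvelopingAlgebra.lift ℂ φ a • v := by
    -- `U(ℋ)` acts on `v` through `φ`, since `ℋ` does and generates it
    let S : Subalgebra ℂ UH :=
      { carrier := {a | A (inclU a) v = UniversalEnvelopingAlgebra.lift ℂ φ a • v}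
        add_mem' := fun {a b} (ha : A (inclU a) v = _) (hb : A (inclU b) v = _) => by
          rw [Set.mem_ofPred_eq, map_add, map_add, LinearMap.add_apply, ha, hb, map_add, add_smul]
        mul_mem' := fun {a b} (ha : A (inclU a) v = _) (hb : A (inclU b) v = _) => by
          rw [Set.mem_ofPred_eq, map_mul, map_mul, Module.End.mul_apply, hb, map_smul, ha, map_mul,
            smul_smul, mul_comm]
        algebraMap_mem' := fun c => by
          rw [Set.mem_ofPred_eq, AlgHom.commutes, AlgHom.commutes, AlgHom.commutes,
            Module.algebraMap_end_apply]
          rfl }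
    have hS : S = ⊤ := UniversalEnvelopingAlgebra.eq_top_of_ι_mem S fun x => by
      change A (inclU _) v = UniversalEnvelopingAlgebra.lift ℂ φ _ • v
      rw [inclU_ι, UniversalEnvelopingAlgebra.lift_ι_apply, hv]
    intro a
    have : a ∈ S := hS ▸ Algebra.mem_top
    exact this
  have hbal : balancing φ ≤ K := by
    refine Submodule.span_le.mpr ?_
    rintro _ ⟨u, a, c, rfl⟩
    change tensorLift φ A v _ = 0
    rw [map_sub, tensorLift_tmul, tensorLift_tmul, map_mul, Module.End.mul_apply, map_smul, hUH,
      OneDim.coord_UH_smul, smul_smul, mul_comm, sub_self]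
  have hW : W φ ξ ≤ K.map (balancing φ).mkQ := by
    refine Submodule.span_le.mpr (Set.singleton_subset_iff.mpr
      ⟨(C φ - algebraMap ℂ U ξ) • (1 ⊗ₜ[ℂ] OneDim.w φ), ?_, rfl⟩)
    change tensorLift φ A v _ = 0
    have h1 : tensorLift φ A v (1 ⊗ₜ[ℂ] OneDim.w φ) = v := by
      rw [tensorLift_tmul, map_one, Module.End.one_apply, OneDim.coord_w, one_smul]
    rw [tensorLift_smul, h1, map_sub, LinearMap.sub_apply, hC, AlgHom.commutes,
      Module.algebraMap_end_apply, sub_self]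
  intro hw
  obtain ⟨k, hk, hkw⟩ := hW hw
  have h2 := hbal ((Submodule.Quotient.eq _).mp hkw)
  have h3 : (1 ⊗ₜ[ℂ] OneDim.w φ : U ⊗[ℂ] OneDim φ) ∈ K := by
    have := K.sub_mem hk h2
    rwa [sub_sub_cancel] at this
  have h4 : tensorLift φ A v (1 ⊗ₜ[ℂ] OneDim.w φ) = 0 := h3
  rw [tensorLift_tmul, map_one, Module.End.one_apply, OneDim.coord_w, one_smul] at h4
  exact hv0 h4

/-- The image of `w` in `L_{φ,ξ}`. -/
def L.w (ξ : ℂ) : L φ ξ := (W φ ξ).mkQ (M.w φ)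

theorem L.lie_def (ξ : ℂ) (x : Schrodinger) (u : L φ ξ) : ⁅x, u⁆ = toU x • u := rfl

theorem L.lieC_w (ξ : ℂ) : ⁅lieC φ, L.w φ ξ⁆ = ξ • L.w φ ξ := by
  have h : (W φ ξ).mkQ ((C φ - algebraMap ℂ U ξ) • M.w φ) = 0 :=
    (Submodule.Quotient.mk_eq_zero _).mpr (Submodule.subset_span rfl)
  rw [map_smul, sub_smul, sub_eq_zero, algebraMap_smul] at h
  exact h

theorem M.heisenberg_smul_w (x : heisenberg) : toU (x : Schrodinger) • M.w φ = φ x • M.w φ := by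
  have h : ((1 : U) * inclU (UniversalEnvelopingAlgebra.ι ℂ x)) ⊗ₜ[ℂ] OneDim.w φ
      - 1 ⊗ₜ[ℂ] (UniversalEnvelopingAlgebra.ι ℂ x • OneDim.w φ) ∈ balancing φ :=
    Submodule.subset_span ⟨1, _, _, rfl⟩
  have h2 : UniversalEnvelopingAlgebra.ι ℂ x • OneDim.w φ = φ x • OneDim.w φ := by
    change (UniversalEnvelopingAlgebra.lift ℂ φ (UniversalEnvelopingAlgebra.ι ℂ x)) • (1 : ℂ) = _
    rw [UniversalEnvelopingAlgebra.lift_ι_apply]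
    rfl
  rw [h2, one_mul, inclU_ι, TensorProduct.tmul_smul] at h
  have h3 := (Submodule.Quotient.eq _).mpr h
  have h4 : toU (x : Schrodinger) • M.w φ
      = Submodule.Quotient.mk (toU (x : Schrodinger) ⊗ₜ[ℂ] OneDim.w φ) := by
    rw [M.w, ← Submodule.Quotient.mk_smul, TensorProduct.smul_tmul', smul_eq_mul, mul_one]
  rw [h4, h3]
  rfl

/-- The vector `w` generates `M_φ` over `U(𝔖)`. -/
theorem M.exists_smul_w (m : M φ) : ∃ u : U, m = u • M.w φ := by
  obtain ⟨t, rfl⟩ := Submodule.Quotient.mk_surjective _ m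
  induction t using TensorProduct.induction_on with
  | zero => exact ⟨0, by rw [zero_smul]; rfl⟩
  | add s t hs ht =>
    obtain ⟨a, ha⟩ := hs
    obtain ⟨b, hb⟩ := ht
    exact ⟨a + b, by rw [Submodule.Quotient.mk_add, ha, hb, add_smul]⟩
  | tmul u c =>
    refine ⟨OneDim.coord φ c • u, ?_⟩
    rw [M.w, ← Submodule.Quotient.mk_smul, TensorProduct.smul_tmul', smul_eq_mul, mul_one,
      TensorProduct.smul_tmul, OneDim.coord_smul_w]

theorem L.lieSpan_w (ξ : ℂ) : LieSubmodule.lieSpan ℂ Schrodinger {L.w φ ξ} = ⊤ := by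
  set N := LieSubmodule.lieSpan ℂ Schrodinger {L.w φ ξ}
  let S : Subalgebra ℂ U :=
    { carrier := {u | ∀ n ∈ N, u • n ∈ N}
      add_mem' := fun {a b} ha hb n hn => by rw [add_smul]; exact N.add_mem (ha n hn) (hb n hn)
      mul_mem' := fun {a b} ha hb n hn => by rw [mul_smul]; exact ha _ (hb n hn)
      algebraMap_mem' := fun c n hn => by rw [algebraMap_smul]; exact N.smul_mem c hn }
  have hS : S = ⊤ := UniversalEnvelopingAlgebra.eq_top_of_ι_mem S fun x n hn => N.lie_mem hn
  refine eq_top_iff.mpr fun l _ => ?_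
  obtain ⟨m, rfl⟩ := (W φ ξ).mkQ_surjective l
  obtain ⟨u, rfl⟩ := M.exists_smul_w φ m
  rw [map_smul]
  have hu : u ∈ S := hS ▸ Algebra.mem_top
  exact hu _ (LieSubmodule.subset_lieSpan rfl)

/-- The polynomial model, pulled back along the inverse of the automorphism `σ`, shows that
`L_{φ,ξ}` is nonzero. -/
theorem L.w_ne_zero (hφ : φ heisenbergP ≠ 0 ∨ φ heisenbergQ ≠ 0) (ξ : ℂ) : L.w φ ξ ≠ 0 := by
  obtain ⟨σ, hσ, hσF, hσZ, ⟨α, β, h, hσP⟩, hσQ⟩ := exists_automorphism φ hφ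
  let τ : Schrodinger ≃ₗ⁅ℂ⁆ Schrodinger := LieEquiv.ofBijective σ hσ
  have hτ : ∀ x y, σ x = y → τ.symm y = x := by
    rintro x _ rfl
    exact τ.symm_apply_apply x
  let A : U →ₐ[ℂ] Module.End ℂ SchrodingerModel :=
    UniversalEnvelopingAlgebra.lift ℂ ((SchrodingerModel.rep ξ).comp τ.symm.toLieHom)
  have hA : ∀ x y, σ x = y → A (toU y) 1 = SchrodingerModel.rep ξ x 1 := by
    intro x y hxy
    rw [UniversalEnvelopingAlgebra.lift_ι_apply, LieHom.comp_apply]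
    change SchrodingerModel.rep ξ (τ.symm y) 1 = _
    rw [hτ x y hxy]
  intro hw
  refine w_notMem_W φ A (v := 1) one_ne_zero ?_ (ξ := ξ) ?_ ((Submodule.Quotient.mk_eq_zero _).mp hw)
  · rintro ⟨x, hx⟩
    have hx' := hx
    change x ∈ Submodule.span ℂ {P, Q, Z} at hx'
    obtain ⟨a, b, c, rfl⟩ := Submodule.mem_span_triple.mp hx'
    have hφx : φ ⟨a • P + b • Q + c • Z, hx⟩ = a * φ heisenbergP + b * φ heisenbergQ := by
      change φ (a • heisenbergP + b • heisenbergQ + c • heisenbergZ) = _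
      simp only [map_add, map_smul, map_heisenbergZ, smul_eq_mul, mul_zero, add_zero]
    rw [hφx]
    -- the inverse of `σ` sends `a p + b q + c z` to `φ(a p + b q) p + (a multiple of q) + c z`
    rw [hA ((a * φ heisenbergP + b * φ heisenbergQ) • P + (b * α - a * β) • Q + c • Z)]
    · simp only [map_add, map_smul, SchrodingerModel.rep_P, SchrodingerModel.rep_Q,
        SchrodingerModel.rep_Z, LinearMap.add_apply, LinearMap.smul_apply,
        SchrodingerModel.opP_apply, SchrodingerModel.opQ_apply]
      simp
    · simp only [map_add, map_smul, hσP, hσQ, hσZ]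
      have ha : a • P = (a * (α * φ heisenbergP + β * φ heisenbergQ)) • P := by rw [h, mul_one]
      have hb : b • Q = (b * (α * φ heisenbergP + β * φ heisenbergQ)) • Q := by rw [h, mul_one]
      rw [ha, hb]
      module
  · change A (toU (lieC φ)) 1 = ξ • 1
    rw [hA F _ hσF, SchrodingerModel.rep_F, SchrodingerModel.opF_apply]
    simp

theorem L.isQuasiWhittakerVector_w (hφ : φ heisenbergP ≠ 0 ∨ φ heisenbergQ ≠ 0) (ξ : ℂ) :
    IsQuasiWhittakerVector φ (L.w φ ξ) := by
  refine ⟨L.w_ne_zero φ hφ ξ, fun x => ?_⟩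
  rw [L.lie_def, L.w, ← map_smul, M.heisenberg_smul_w]
  rfl

end Schrodinger

end

theorem theorem4p3
    (φ : Schrodinger.heisenberg →ₗ⁅ℂ⁆ ℂ)
    (hφ : φ Schrodinger.heisenbergP ≠ 0 ∨ φ Schrodinger.heisenbergQ ≠ 0) :
    -- every `L_{φ,ξ}` is a simple quasi-Whittaker module of type `φ`
    (∀ ξ : ℂ,
      LieModule.IsIrreducible ℂ Schrodinger (Schrodinger.L φ ξ) ∧
      Schrodinger.IsQuasiWhittakerModule φ (Schrodinger.L φ ξ)) ∧
    -- they are pairwise non-isomorphic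
    (∀ ξ ξ' : ℂ,
      Nonempty (Schrodinger.L φ ξ ≃ₗ⁅ℂ, Schrodinger⁆ Schrodinger.L φ ξ') → ξ = ξ') ∧
    -- every simple quasi-Whittaker module of type `φ` is isomorphic to some `L_{φ,ξ}`,
    -- and `ξ` is the scalar by which `C₀` acts
    (∀ (V : Type*) [AddCommGroup V] [Module ℂ V]
        [LieRingModule Schrodinger V] [LieModule ℂ Schrodinger V],
      LieModule.IsIrreducible ℂ Schrodinger V →
      Schrodinger.IsQuasiWhittakerModule φ V →
        (∃ ξ : ℂ, Nonempty (V ≃ₗ⁅ℂ, Schrodinger⁆ Schrodinger.L φ ξ)) ∧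
        (∀ ξ : ℂ, Nonempty (V ≃ₗ⁅ℂ, Schrodinger⁆ Schrodinger.L φ ξ) ↔
          Schrodinger.C₀ActsBy V ξ)) := by
  have hw := Schrodinger.L.isQuasiWhittakerVector_w φ hφ
  have hgenL := Schrodinger.L.lieSpan_w φ
  have hCL := Schrodinger.L.lieC_w φ
  have hL (ξ : ℂ) : Schrodinger.C₀ActsBy (Schrodinger.L φ ξ) ξ :=
    Schrodinger.c₀ActsBy_of_apply_eq (hw ξ) (hgenL ξ) (hCL ξ)
  refine ⟨fun ξ => ⟨Schrodinger.isIrreducible_of_lieC hφ (hw ξ) (hCL ξ) (hgenL ξ),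
    _, hw ξ, hgenL ξ⟩, ?_, ?_⟩
  · rintro ξ ξ' ⟨ψ⟩
    have h := (Schrodinger.c₀ActsBy_congr (hL ξ') ψ) (Schrodinger.L.w φ ξ)
    rw [hL ξ] at h
    exact smul_left_injective ℂ (hw ξ).1 h
  · intro V _ _ _ _ hV hqw
    obtain ⟨v, hv, hgen⟩ := hqw
    have hiff : ∀ ξ : ℂ, Nonempty (V ≃ₗ⁅ℂ, Schrodinger⁆ Schrodinger.L φ ξ) ↔
        Schrodinger.C₀ActsBy V ξ := by
      refine fun ξ => ⟨fun ⟨ψ⟩ => Schrodinger.c₀ActsBy_congr (hL ξ) ψ, fun h => ?_⟩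
      have hC : ⁅Schrodinger.lieC φ, v⁆ = ξ • v := by
        rw [← Schrodinger.actU_C₀_eq_lieC hv, h]
      exact Schrodinger.nonempty_equiv_of_lieC hφ hv hC hgen (hw ξ) (hCL ξ) (hgenL ξ)
    obtain ⟨ξ, hξ⟩ := Schrodinger.exists_c₀ActsBy hv hgen
    exact ⟨⟨ξ, (hiff ξ).mpr hξ⟩, hiff⟩
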